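/- For integers $d\ge 1$, let $PC(d)$ denote the projective hypercube of dimension $d$, i.e. the Cayley graph on $\mathbb{Z}_2^{d}$ with generating set $\{e_1,\dots,e_d,J\}$, where $e_1,\dots,e_d$ is the standard basis and $J$ is the all-ones vector. The odd-girth of a graph is the smallest length of an odd cycle in it (and $\infty$ if it has no odd cycle). For $k\ge 1$, let $\mathcal{SP}_{2k+1}$ be the class of finite simple graphs that do not have $K_4$ as a minor and have odd-girth at least $2k+1$. Theorem. For every integer $k\ge 1$, the projective hypercube $PC(2k)$ bounds $\mathcal{SP}_{2k+1}$; that is, every graph $G\in\mathcal{SP}_{2k+1}$ admits a homomorphism to $PC(2k)$ (a map $V(G)\to V(PC(2k))$ sending adjacent vertices to adjacent vertices). In other words, Naserasr's conjecture (that $PC(2k)$ bounds the class of planar graphs of odd-girth at least $2k+1$) holds when restricted to $K_4$-minor-free graphs. -/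

import Mathlib

namespace HomBound

universe u v

/-- `H` is a minor of `G`: there are pairwise disjoint vertex sets `B w` (the branch sets), each
inducing a nonempty connected subgraph of `G`, such that `G` has an edge between `B x` and `B y`
whenever `x` and `y` are adjacent in `H`. For finite graphs this says that `H` can be obtained from
`G` by edge contractions and vertex and edge deletions: delete the vertices outside all branch sets,
contract each branch set to a single vertex, and delete superfluous edges. -/
def IsMinor {W : Type v} {V : Type u} (H : SimpleGraph W) (G : SimpleGraph V) : Prop :=
  ∃ B : W → Set V,
    (∀ w, (G.induce (B w)).Connected) ∧
    (∀ x y, x ≠ y → Disjoint (B x) (B y)) ∧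
    (∀ x y, H.Adj x y → ∃ a ∈ B x, ∃ b ∈ B y, G.Adj a b)

/-- The odd-girth of `G`: the smallest length of an odd cycle (`⊤` if there is no odd cycle). -/
noncomputable def oddGirth {V : Type u} (G : SimpleGraph V) : ℕ∞ :=
  ⨅ (a : V) (w : G.Walk a a) (_ : w.IsCycle) (_ : Odd w.length), (w.length : ℕ∞)

/-- A class of finite graphs with vertex types in a fixed (arbitrary) universe. -/
abbrev GraphClass := ∀ V : Type u, [Finite V] → SimpleGraph V → Prop

/-- `H` bounds the class `C`: every finite graph in `C` admits a homomorphism to `H`. -/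
def Bounds {W : Type v} (H : SimpleGraph W) (C : GraphClass.{u}) : Prop :=
  ∀ (V : Type u) [Finite V] (G : SimpleGraph V), C V G → Nonempty (G →g H)

/-- The class `SP n` of finite `K₄`-minor-free graphs of odd-girth at least `n`. -/
def SP (n : ℕ) : GraphClass.{u} := fun _V _ G =>
  ¬ IsMinor (SimpleGraph.completeGraph (Fin 4)) G ∧ (n : ℕ∞) ≤ oddGirth G

/-- The projective hypercube of dimension `d`: the Cayley graph of `(ℤ/2ℤ)^d` with respect to the
standard basis `e₁, …, e_d` and the all-ones vector `J`. -/
def projectiveHypercube (d : ℕ) : SimpleGraph (Fin d → ZMod 2) :=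
  SimpleGraph.addCayley (Set.range (fun i : Fin d => (Pi.single i 1 : Fin d → ZMod 2)) ∪ {1})

end HomBound

/-! Identifying complementary subsets of a `(2k+1)`-set gives `PC(2k)`, and sets at Hamming distance
`2k` become adjacent. So it suffices to label vertices by subsets with adjacent ones at distance
`2k`.

Distances are prescribed for all pairs of vertices: cap the graph distance at `k` (value `k` across
components) and take the even one of `d` and `2k+1-d`, which is `2k` on edges. The odd-girth
hypothesis makes every triple realizable in the cube (`evenDist_bounds`): triangle inequalities and
perimeter at most `2(2k+1)`.

A `K₄`-minor-free graph with an edge has a vertex `v` of degree one or two (`exists_isThin`).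
Contracting `v` into one neighbour joins its two neighbours, so a labelling of the smaller graph
puts these at the prescribed distance, and realizability of the triple supplies a label for `v`
(`exists_labelling`). -/

namespace HomBound

universe u v w

/-! ### Contractions and vertices of small degree in `K₄`-minor-free graphs -/

section Minors

variable {V : Type u} {W : Type v} {X : Type w}

/-- Connected vertex sets pull back to connected vertex sets along a map whose fibres are
cliques. -/
theorem reachable_induce_preimage_of_map {G : SimpleGraph V} {φ : V → X}
    (hφ : ∀ a b, φ a = φ b → a = b ∨ G.Adj a b) {S : Set X} {s t : S}
    (p : ((G.map φ).induce S).Walk s t) (a b : φ ⁻¹' S) (ha : φ a = s) (hb : φ b = t) :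
    (G.induce (φ ⁻¹' S)).Reachable a b := by
  have fibre : ∀ a b : φ ⁻¹' S, φ a = φ b → (G.induce (φ ⁻¹' S)).Reachable a b := by
    intro a b hab
    rcases hφ a b hab with h | h
    · rw [Subtype.ext h]
    · exact SimpleGraph.Adj.reachable (by simpa using h)
  induction p generalizing a with
  | nil => exact fibre a b (ha.trans hb.symm)
  | @cons s s' t h p ih =>
    obtain ⟨-, a', b', hab, ha', hb'⟩ := h
    let a₁ : φ ⁻¹' S := ⟨a', by simp [ha']⟩
    let b₁ : φ ⁻¹' S := ⟨b', by simp [hb']⟩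
    have h₁ : (G.induce (φ ⁻¹' S)).Adj a₁ b₁ := hab
    exact (fibre a a₁ (ha.trans ha'.symm)).trans (h₁.reachable.trans (ih b₁ hb' hb))

/-- A minor of a contraction is a minor, if the minor has no isolated vertex. -/
theorem IsMinor.of_map {H : SimpleGraph W} {G : SimpleGraph V} {φ : V → X}
    (hφ : ∀ a b, φ a = φ b → a = b ∨ G.Adj a b) (hH : ∀ x, ∃ y, H.Adj x y)
    (h : IsMinor H (G.map φ)) : IsMinor H G := by
  obtain ⟨B, hc, hd, he⟩ := h
  refine ⟨fun w => φ ⁻¹' B w, fun w => ?_, fun x y hxy => (hd x y hxy).preimage φ,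
    fun x y hxy => ?_⟩
  -- A branch set may miss the image of `φ` only if it has no outgoing edge; a neighbour of `w`
  -- rules this out and makes the preimage nonempty.
  · obtain ⟨y, hy⟩ := hH w
    obtain ⟨a, ha, b, hb, -, a', b', -, rfl, rfl⟩ := he w y hy
    have : Nonempty (φ ⁻¹' B w) := ⟨⟨a', ha⟩⟩
    refine ⟨fun c d => ?_⟩
    obtain ⟨p⟩ := (hc w).preconnected ⟨φ c, c.2⟩ ⟨φ d, d.2⟩
    exact reachable_induce_preimage_of_map hφ p c d rfl rfl
  · obtain ⟨a, ha, b, hb, -, a', b', hab, rfl, rfl⟩ := he x y hxy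
    exact ⟨a', ha, b', hb, hab⟩

open Classical in
/-- The graph obtained from `G` by contracting `y` into `x`; the vertex `y` is kept as an isolated
vertex. -/
noncomputable def contract (G : SimpleGraph V) (x y : V) : SimpleGraph V := G.map (Function.update id y x)

theorem contract_adj {G : SimpleGraph V} {x y : V} (hxy : x ≠ y) {a b : V} :
    (contract G x y).Adj a b ↔ a ≠ b ∧ a ≠ y ∧ b ≠ y ∧
      (G.Adj a b ∨ (a = x ∧ G.Adj y b) ∨ (b = x ∧ G.Adj y a)) := by
  simp only [contract, SimpleGraph.map_adj', Function.update_apply, id]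
  constructor
  · rintro ⟨hab, a', b', h, ha, hb⟩
    have := h.symm
    grind
  · rintro ⟨hab, ha, hb, h | ⟨rfl, h⟩ | ⟨rfl, h⟩⟩
    · exact ⟨hab, a, b, h, by grind⟩
    · exact ⟨hab, y, b, h, by grind⟩
    · exact ⟨hab, a, y, h.symm, by grind⟩

/-- The complete graph on four vertices is a minor of `G`. -/
def HasK4Minor (G : SimpleGraph V) : Prop := IsMinor (SimpleGraph.completeGraph (Fin 4)) G

theorem HasK4Minor.of_contract {G : SimpleGraph V} {x y : V} (hxy : G.Adj x y)
    (h : HasK4Minor (contract G x y)) : HasK4Minor G := by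
  classical
  refine IsMinor.of_map (φ := Function.update id y x) (fun a b hab => ?_) (fun x => ?_)
    (by unfold HasK4Minor contract at h; convert h)
  · have := hxy.symm
    simp only [Function.update_apply, id] at hab
    grind
  · exact ⟨x + 1, by simp⟩

theorem hasK4Minor_of_adj {G : SimpleGraph V} {a b c d : V} (hab : G.Adj a b) (hac : G.Adj a c)
    (had : G.Adj a d) (hbc : G.Adj b c) (hbd : G.Adj b d) (hcd : G.Adj c d) : HasK4Minor G := by
  have key : ∀ x y : Fin 4, x ≠ y → G.Adj (![a, b, c, d] x) (![a, b, c, d] y) := by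
    intro x y hxy
    fin_cases x <;> fin_cases y <;> simp_all [G.adj_comm]
  refine ⟨fun i => {![a, b, c, d] i}, fun i => ?_, fun x y hxy => ?_, fun x y hxy => ?_⟩
  · have : Nonempty ({![a, b, c, d] i} : Set V) := ⟨⟨_, rfl⟩⟩
    exact ⟨.of_subsingleton⟩
  · exact Set.disjoint_singleton.2 (key x y hxy).ne
  · exact ⟨_, rfl, _, rfl, key x y hxy⟩

theorem ncard_support_contract_lt [Finite V] {G : SimpleGraph V} {x y : V} (hxy : G.Adj x y) :
    (contract G x y).support.ncard < G.support.ncard := by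
  refine Set.ncard_lt_ncard (Set.ssubset_iff_exists.2 ⟨?_, y, ⟨x, hxy.symm⟩, ?_⟩) (Set.toFinite _)
  · rintro a ⟨b, hab⟩
    obtain ⟨-, -, -, h | ⟨rfl, -⟩ | ⟨-, h⟩⟩ := (contract_adj hxy.ne).1 hab
    · exact ⟨b, h⟩
    · exact ⟨y, hxy⟩
    · exact ⟨y, h.symm⟩
  · rintro ⟨b, h⟩
    exact ((contract_adj hxy.ne).1 h).2.1 rfl

/-- `v` has at most two neighbours. -/
def IsThin (G : SimpleGraph V) (v : V) : Prop := ∃ p q, ∀ z, G.Adj v z → z = p ∨ z = q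

/-- If contracting the edge `xy` produces a thin vertex, then this is either the contracted vertex
or a common neighbour of `x` and `y`. -/
theorem thin_contract {G : SimpleGraph V} (hG : ∀ v ∈ G.support, ¬ IsThin G v) {x y v : V}
    (hxy : G.Adj x y) (hv : v ∈ (contract G x y).support) (ht : IsThin (contract G x y) v) :
    (∃ p q, (∀ z, G.Adj x z → z = y ∨ z = p ∨ z = q) ∧ ∀ z, G.Adj y z → z = x ∨ z = p ∨ z = q) ∨
      ∃ v q, G.Adj v x ∧ G.Adj v y ∧ ∀ z, G.Adj v z → z = x ∨ z = y ∨ z = q := by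
  obtain ⟨p, q, ht⟩ := ht
  obtain ⟨w, hw⟩ := hv
  simp only [contract_adj hxy.ne] at ht hw
  have hyx := hxy.symm
  have hvy : v ≠ y := hw.2.1
  by_cases hvx : v = x
  · subst hvx
    left
    refine ⟨p, q, fun z hz => ?_, fun z hz => ?_⟩
    · have := hz.ne
      grind
    · have := hz.ne
      grind
  · right
    have hvs : v ∈ G.support := by
      rcases hw.2.2.2 with h | ⟨h, -⟩ | ⟨-, h⟩
      · exact ⟨w, h⟩
      · exact absurd h hvx
      · exact ⟨y, h.symm⟩
    have hthick := hG v hvs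
    have hn : ∀ z, G.Adj v z → z = y ∨ z = p ∨ z = q := fun z hz => by
      have := hz.ne
      grind
    have h1 : G.Adj v y := by
      by_contra h
      exact hthick ⟨p, q, fun z hz => by have := hn z hz; grind⟩
    have h2 : x = p ∨ x = q := ht x ⟨hvx, hvy, hxy.ne, .inr (.inr ⟨rfl, h1.symm⟩)⟩
    have h3 : G.Adj v x := by
      by_contra h
      rcases h2 with rfl | rfl
      · exact hthick ⟨y, q, fun z hz => by have := hn z hz; grind⟩
      · exact hthick ⟨y, p, fun z hz => by have := hn z hz; grind⟩
    rcases h2 with rfl | rfl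
    · exact ⟨v, q, h3, h1, fun z hz => by have := hn z hz; grind⟩
    · exact ⟨v, p, h3, h1, fun z hz => by have := hn z hz; grind⟩

/-- A finite graph with an edge and without `K₄`-minor has a vertex with one or two neighbours. -/
theorem exists_isThin [Finite V] (G : SimpleGraph V) (hne : G.support.Nonempty)
    (hK : ¬ HasK4Minor G) : ∃ v ∈ G.support, IsThin G v := by
  induction hm : G.support.ncard using Nat.strong_induction_on generalizing G with
  | _ m ih =>
  subst hm
  by_contra! hG
  have hmin : ∀ G' : SimpleGraph V, G'.support.ncard < G.support.ncard → G'.support.Nonempty →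
      ¬ HasK4Minor G' → ∃ v ∈ G'.support, IsThin G' v := fun G' h1 h2 h3 => ih _ h1 G' h2 h3 rfl
  have hthick : ∀ {v z}, G.Adj v z → ∀ p q, ∃ z, G.Adj v z ∧ z ≠ p ∧ z ≠ q := by
    intro v z h p q
    by_contra! h'
    exact hG v ⟨z, h⟩ ⟨p, q, fun z hz => by have := h' z hz; grind⟩
  -- the alternatives for an edge that cannot be contracted
  have hedge : ∀ {x y}, G.Adj x y →
      (∃ p q, (∀ z, G.Adj x z → z = y ∨ z = p ∨ z = q) ∧
        ∀ z, G.Adj y z → z = x ∨ z = p ∨ z = q) ∨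
      ∃ v q, G.Adj v x ∧ G.Adj v y ∧ ∀ z, G.Adj v z → z = x ∨ z = y ∨ z = q := by
    intro x y hxy
    -- A second neighbour of `x` survives as an edge of the contraction, so minimality applies.
    obtain ⟨z, hz, hzy, -⟩ := hthick hxy y y
    have hz' : (contract G x y).Adj x z :=
      (contract_adj hxy.ne).2 ⟨hz.ne, hxy.ne, hzy, .inl hz⟩
    obtain ⟨v, hv, ht⟩ := hmin _ (ncard_support_contract_lt hxy) ⟨x, z, hz'⟩
      fun h => hK (h.of_contract hxy)
    exact thin_contract hG hxy hv ht
  -- a triangle `xyz` in which `z` has exactly three neighbours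
  obtain ⟨x, y, z, t, hxy, hzx, hzy, hzt, htx, hty, hz⟩ : ∃ x y z t, G.Adj x y ∧ G.Adj z x ∧
      G.Adj z y ∧ G.Adj z t ∧ t ≠ x ∧ t ≠ y ∧ ∀ s, G.Adj z s → s = x ∨ s = y ∨ s = t := by
    have main : ∃ x y z q, G.Adj x y ∧ G.Adj z x ∧ G.Adj z y ∧
        ∀ s, G.Adj z s → s = x ∨ s = y ∨ s = q := by
      obtain ⟨x, y, hxy⟩ := hne
      -- In the first case `x` and `y` both have `p` and `q` as neighbours, so `y` is the
      -- degree-three vertex of the triangle `x`, `p`, `y`.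
      rcases hedge hxy with ⟨p, q, hx, hy⟩ | ⟨v, q, h1, h2, h3⟩
      · obtain ⟨s, hs, hsy, hsq⟩ := hthick hxy y q
        obtain ⟨s', hs', hsx', hsq'⟩ := hthick hxy.symm x q
        have h1 : s = p := by have := hx s hs; grind
        have h2 : s' = p := by have := hy s' hs'; grind
        subst h1
        subst h2
        exact ⟨x, s', y, q, hs, hxy.symm, hs', fun s h => hy s h⟩
      · exact ⟨x, y, v, q, hxy, h1, h2, h3⟩
    obtain ⟨x, y, z, q, hxy, hzx, hzy, h⟩ := main
    obtain ⟨t, ht, htx, hty⟩ := hthick hzx x y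
    have : t = q := by have := h t ht; grind
    subst this
    exact ⟨x, y, z, t, hxy, hzx, hzy, ht, htx, hty, h⟩
  -- a diamond: adjacent `x`, `z`, each with the further neighbours `y`, `t`
  obtain ⟨x, z, y, t, hxz, hxy, hxt, hzy, hzt, hyt, hx, hz⟩ : ∃ x z y t, G.Adj x z ∧ G.Adj x y ∧
      G.Adj x t ∧ G.Adj z y ∧ G.Adj z t ∧ y ≠ t ∧ (∀ s, G.Adj x s → s = z ∨ s = y ∨ s = t) ∧
      ∀ s, G.Adj z s → s = x ∨ s = y ∨ s = t := by
    -- In the first case `t` is adjacent to `x` and `y`, which yields a `K₄`. In the second the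
    -- common neighbour of `z` and `t` is `x` or `y`, and it has degree three.
    rcases hedge hzt with ⟨p, q, h1, h2⟩ | ⟨v, q, h1, h2, h3⟩
    · have hx' := h1 x hzx
      have hy' := h1 y hzy
      have hne := hxy.ne
      obtain ⟨s, hs, hs1, hs2⟩ := hthick hzt.symm z x
      obtain ⟨s', hs', hs1', hs2'⟩ := hthick hzt.symm z y
      have e1 : s = y := by have := h2 s hs; grind
      have e2 : s' = x := by have := h2 s' hs'; grind
      subst e1
      subst e2
      exact absurd (hasK4Minor_of_adj hxy hzx.symm hs'.symm hzy.symm hs.symm hzt) hK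
    · have hv := hz v h1.symm
      have hvt := h2.ne
      rcases hv with rfl | rfl | rfl
      · exact ⟨v, z, y, t, h1, hxy, h2, hzy, hzt, hty.symm,
          fun s hs => by
            have a1 := h3 s hs
            have a2 := h3 y hxy
            have := hzy.ne
            grind,
          fun s hs => hz s hs⟩
      · exact ⟨v, z, x, t, h1, hxy.symm, h2, hzx, hzt, htx.symm,
          fun s hs => by
            have a1 := h3 s hs
            have a2 := h3 x hxy.symm
            have := hzx.ne
            grind,
          fun s hs => by have := hz s hs; grind⟩
      · exact absurd rfl hvt
  have hnyt : ¬ G.Adj y t := fun h => hK (hasK4Minor_of_adj hxz hxy hxt hzy hzt h)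
  -- no end of the diamond has exactly three neighbours
  have hend : ∀ {x z y t}, G.Adj x z → G.Adj x y → G.Adj z y → ¬ G.Adj y t →
      (∀ s, G.Adj x s → s = z ∨ s = y ∨ s = t) → (∀ s, G.Adj z s → s = x ∨ s = y ∨ s = t) →
      ∀ s, G.Adj y s → s ≠ x → s ≠ z → ∃ s', G.Adj y s' ∧ s' ≠ x ∧ s' ≠ z ∧ s' ≠ s := by
    intro x z y t hxz hxy hzy hnyt hx hz s hys hsx hsz
    by_contra! hcon
    have hst : s ≠ t := fun h => hnyt (h ▸ hys)
    have hxs : ¬ G.Adj x s := fun h => by have := hx s h; have := hys.ne; grind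
    have hzs : ¬ G.Adj z s := fun h => by have := hz s h; have := hys.ne; grind
    -- Both cases would make `s` adjacent to `x` or `z`, whose neighbourhoods exclude it.
    rcases hedge hys with ⟨p, q, h1, h2⟩ | ⟨v, q, h1, h2, -⟩
    · obtain ⟨r, hr, hr1, hr2⟩ := hthick hys.symm y y
      have a1 := h1 x hxy.symm
      have a2 := h1 z hzy.symm
      have a3 := h2 r hr
      have a4 := hxz.ne
      have : r = x ∨ r = z := by grind
      rcases this with rfl | rfl
      · exact hxs hr.symm
      · exact hzs hr.symm
    · have a1 := hcon v h1.symm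
      have a2 := h2.ne
      by_cases hvx : v = x
      · exact hxs (hvx ▸ h2)
      · by_cases hvz : v = z
        · exact hzs (hvz ▸ h2)
        · exact a2 (a1 hvx hvz)
  -- contract `x` and `z` into `y`
  have hyx := hxy.symm
  have hyz := hzy.symm
  have htx := hxt.symm
  have htz := hzt.symm
  have hzx := hxz.symm
  let G₁ := contract G y x
  have hyz₁ : G₁.Adj y z := (contract_adj hyx.ne).2 ⟨hyz.ne, hyx.ne, hzx.ne, .inl hyz⟩
  let G₂ := contract G₁ y z
  have hadj : ∀ a b, G₂.Adj a b ↔ a ≠ x ∧ a ≠ z ∧ b ≠ x ∧ b ≠ z ∧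
      (G.Adj a b ∨ (a = y ∧ b = t) ∨ (a = t ∧ b = y)) := by
    intro a b
    have e1 := hyx.ne
    have e2 := hyz.ne
    have e3 := hxz.ne
    have e4 := htx.ne
    have e5 := htz.ne
    simp only [G₂, G₁, contract_adj e2, contract_adj e1]
    have n1 := hx a
    have n2 := hx b
    have n3 := hz a
    have n4 := hz b
    have n5 := G.adj_comm a b
    have n6 : G.Adj a b → a ≠ b := fun h => h.ne
    grind
  have hK₂ : ¬ HasK4Minor G₂ := fun h => hK ((h.of_contract hyz₁).of_contract hyx)
  have hyt₂ : G₂.Adj y t :=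
    (hadj y t).2 ⟨hyx.ne, hyz.ne, htx.ne, htz.ne, .inr (.inl ⟨rfl, rfl⟩)⟩
  obtain ⟨v, ⟨s, hs⟩, p, q, hpq⟩ := hmin G₂
    ((ncard_support_contract_lt hyz₁).trans (ncard_support_contract_lt hyx)) ⟨y, t, hyt₂⟩ hK₂
  -- an end of the diamond keeps at least three neighbours
  have hkeep : ∀ {y t}, G.Adj x y → G.Adj z y → G.Adj y x → ¬ G.Adj y t → G₂.Adj y t →
      (∀ s, G.Adj x s → s = z ∨ s = y ∨ s = t) → (∀ s, G.Adj z s → s = x ∨ s = y ∨ s = t) →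
      (∀ s, G₂.Adj y s → s = p ∨ s = q) → False := by
    intro y t hxy hzy hyx hnyt hyt₂ hx hz hpq
    obtain ⟨s, hs, hsx, hsz⟩ := hthick hyx x z
    obtain ⟨s', hs', hsx', hsz', hss'⟩ := hend hxz hxy hzy hnyt hx hz s hs hsx hsz
    have b1 := hpq t hyt₂
    have b2 := hpq s ((hadj _ _).2 ⟨hxy.ne', hzy.ne', hsx, hsz, .inl hs⟩)
    have b3 := hpq s' ((hadj _ _).2 ⟨hxy.ne', hzy.ne', hsx', hsz', .inl hs'⟩)
    have b4 : s ≠ t := fun h => hnyt (h ▸ hs)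
    have b5 : s' ≠ t := fun h => hnyt (h ▸ hs')
    grind
  by_cases hvy : v = y
  · subst hvy
    exact hkeep hxy hzy hyx hnyt hyt₂ hx hz hpq
  by_cases hvt : v = t
  · subst hvt
    exact hkeep hxt hzt htx (fun h => hnyt h.symm) hyt₂.symm (fun s h => by have := hx s h; grind)
      (fun s h => by have := hz s h; grind) hpq
  -- Any other vertex is adjacent to neither `x` nor `z`, so it keeps its neighbourhood and stays
  -- thick.
  obtain ⟨hvx, hvz, hsx, hsz, h⟩ := (hadj v s).1 hs
  have hvs : G.Adj v s := by grind
  obtain ⟨r, hr, hrp, hrq⟩ := hthick hvs p q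
  have c1 : r ≠ x := fun h => by have := hx v (h ▸ hr.symm); grind
  have c2 : r ≠ z := fun h => by have := hz v (h ▸ hr.symm); grind
  have := hpq r ((hadj v r).2 ⟨hvx, hvz, c1, c2, .inl hr⟩)
  grind

end Minors

open scoped symmDiff

/-! ### Odd closed walks and truncated distances -/

section OddWalks

variable {V : Type u}

/-- A walk contains a path of the same parity, unless it contains an odd cycle. -/
theorem exists_isPath_or_oddGirth_le {G : SimpleGraph V} {a b : V} (p : G.Walk a b) :
    (∃ q : G.Walk a b, q.IsPath ∧ (Even q.length ↔ Even p.length)) ∨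
      oddGirth G ≤ p.length := by
  classical
  -- The length bound on `q` ensures that the odd cycle found is no longer than the walk.
  suffices h : (∃ q : G.Walk a b, q.IsPath ∧ q.length ≤ p.length ∧
      (Even q.length ↔ Even p.length)) ∨ oddGirth G ≤ p.length from
    h.imp_left fun ⟨q, h1, _, h2⟩ => ⟨q, h1, h2⟩
  induction p with
  | nil => exact .inl ⟨.nil, by simp⟩
  | @cons a c b h p ih =>
    rcases ih with ⟨q, hq, hle, hpar⟩ | ih
    swap
    · exact .inr (ih.trans (by simp))
    by_cases ha : a ∈ q.support
    · have hlen : (q.takeUntil a ha).length + (q.dropUntil a ha).length = q.length := by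
        rw [← SimpleGraph.Walk.length_append, SimpleGraph.Walk.take_spec]
      -- The edge `ac` closes the initial segment into a cycle. If that cycle is even, cutting it
      -- off preserves parity.
      by_cases hev : Even (q.takeUntil a ha).length
      · right
        have hcyc : (SimpleGraph.Walk.cons h (q.takeUntil a ha)).IsCycle := by
          rw [SimpleGraph.Walk.cons_isCycle_iff]
          refine ⟨hq.takeUntil ha, fun hmem => ?_⟩
          rw [Sym2.eq_swap] at hmem
          rw [(hq.takeUntil ha).length_eq_one_of_mem_edges hmem] at hev
          exact absurd hev (by decide)
        have hodd : Odd (SimpleGraph.Walk.cons h (q.takeUntil a ha)).length := by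
          rw [SimpleGraph.Walk.length_cons]
          exact hev.add_one
        have hle' : oddGirth G ≤ (SimpleGraph.Walk.cons h (q.takeUntil a ha)).length :=
          iInf₂_le_of_le a _ (iInf₂_le hcyc hodd)
        refine hle'.trans ?_
        simp only [SimpleGraph.Walk.length_cons, Nat.cast_le]
        omega
      · left
        refine ⟨q.dropUntil a ha, hq.dropUntil ha, ?_, ?_⟩
        · rw [SimpleGraph.Walk.length_cons]
          omega
        · rw [SimpleGraph.Walk.length_cons]
          grind
    · exact .inl ⟨.cons h q, hq.cons ha, by simpa using hle, by
        simp only [SimpleGraph.Walk.length_cons, Nat.even_add_one, hpar]⟩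

theorem oddGirth_le_length {G : SimpleGraph V} {a : V} (p : G.Walk a a) (hp : Odd p.length) :
    oddGirth G ≤ p.length := by
  rcases exists_isPath_or_oddGirth_le p with ⟨q, hq, h⟩ | h
  · have h0 := SimpleGraph.Walk.length_eq_zero_iff.2 (SimpleGraph.Walk.isPath_iff_nil.1 hq)
    exact absurd (h.1 (by simp [h0])) (Nat.not_even_iff_odd.2 hp)
  · exact h

open Classical in
/-- The distance in `G`, truncated at `k`. -/
noncomputable def truncDist (G : SimpleGraph V) (k : ℕ) (a b : V) : ℕ :=
  if G.Reachable a b then min (G.dist a b) k else k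

theorem truncDist_le (G : SimpleGraph V) (k : ℕ) (a b : V) : truncDist G k a b ≤ k := by
  unfold truncDist
  split_ifs <;> simp

theorem truncDist_self (G : SimpleGraph V) (k : ℕ) (a : V) : truncDist G k a a = 0 := by
  simp [truncDist]

theorem truncDist_comm (G : SimpleGraph V) (k : ℕ) (a b : V) :
    truncDist G k a b = truncDist G k b a := by
  have h : G.Reachable a b ↔ G.Reachable b a := SimpleGraph.reachable_comm
  unfold truncDist
  split_ifs <;> simp_all [SimpleGraph.dist_comm (u := a)]

theorem truncDist_le_length {G : SimpleGraph V} {k : ℕ} {a b : V} (p : G.Walk a b) :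
    truncDist G k a b ≤ p.length := by
  rw [truncDist, if_pos p.reachable]
  exact (min_le_left _ _).trans (SimpleGraph.dist_le p)

theorem exists_walk_of_truncDist_lt {G : SimpleGraph V} {k : ℕ} {a b : V}
    (h : truncDist G k a b < k) : ∃ p : G.Walk a b, p.length = truncDist G k a b := by
  unfold truncDist at h ⊢
  split_ifs at h ⊢ with hr
  · obtain ⟨p, hp⟩ := hr.exists_walk_length_eq_dist
    exact ⟨p, by omega⟩
  · omega

theorem truncDist_triangle (G : SimpleGraph V) (k : ℕ) (a b c : V) :
    truncDist G k a c ≤ truncDist G k a b + truncDist G k b c := by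
  have h := truncDist_le G k a c
  by_cases h1 : truncDist G k a b < k
  · by_cases h2 : truncDist G k b c < k
    · obtain ⟨p, hp⟩ := exists_walk_of_truncDist_lt h1
      obtain ⟨q, hq⟩ := exists_walk_of_truncDist_lt h2
      rw [← hp, ← hq, ← SimpleGraph.Walk.length_append]
      exact truncDist_le_length _
    · omega
  · omega

theorem truncDist_of_adj {G : SimpleGraph V} {k : ℕ} (hk : 1 ≤ k) {a b : V} (h : G.Adj a b) :
    truncDist G k a b = 1 := by
  rw [truncDist, if_pos h.reachable, SimpleGraph.dist_eq_one_iff_adj.2 h]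
  omega

/-- If one distance is `k`, the triangle inequality makes the sum at least `2k`, and it is odd.
Otherwise shortest walks form an odd closed walk of that length. -/
theorem le_truncDist_add_of_odd {G : SimpleGraph V} {k : ℕ}
    (hG : ((2 * k + 1 : ℕ) : ℕ∞) ≤ oddGirth G) {a b c : V}
    (h : Odd (truncDist G k a b + truncDist G k b c + truncDist G k a c)) :
    2 * k + 1 ≤ truncDist G k a b + truncDist G k b c + truncDist G k a c := by
  have t1 := truncDist_triangle G k a b c
  have t2 := truncDist_triangle G k a c b
  have t3 := truncDist_triangle G k b a c
  rw [truncDist_comm G k c b] at t2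
  rw [truncDist_comm G k b a] at t3
  have l1 := truncDist_le G k a b
  have l2 := truncDist_le G k b c
  have l3 := truncDist_le G k a c
  rw [Nat.odd_iff] at h
  by_cases h1 : truncDist G k a b < k
  swap
  · omega
  by_cases h2 : truncDist G k b c < k
  swap
  · omega
  by_cases h3 : truncDist G k a c < k
  swap
  · omega
  obtain ⟨p, hp⟩ := exists_walk_of_truncDist_lt h1
  obtain ⟨q, hq⟩ := exists_walk_of_truncDist_lt h2
  obtain ⟨r, hr⟩ := exists_walk_of_truncDist_lt h3
  have hlen : ((p.append q).append r.reverse).length =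
      truncDist G k a b + truncDist G k b c + truncDist G k a c := by
    simp [hp, hq, hr]
  have := hG.trans (oddGirth_le_length ((p.append q).append r.reverse)
    (by rw [hlen]; exact Nat.odd_iff.2 h))
  rw [hlen] at this
  exact_mod_cast this

/-- Of the numbers `d` and `2 * k + 1 - d`, where `d` is the truncated distance, the even one. -/
noncomputable def evenDist (G : SimpleGraph V) (k : ℕ) (a b : V) : ℕ :=
  if Even (truncDist G k a b) then truncDist G k a b else 2 * k + 1 - truncDist G k a b

theorem even_evenDist (G : SimpleGraph V) (k : ℕ) (a b : V) : Even (evenDist G k a b) := by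
  have := truncDist_le G k a b
  unfold evenDist
  split_ifs with h
  · exact h
  · rw [Nat.even_iff] at h ⊢
    omega

theorem evenDist_self (G : SimpleGraph V) (k : ℕ) (a : V) : evenDist G k a a = 0 := by
  simp [evenDist, truncDist_self]

theorem evenDist_comm (G : SimpleGraph V) (k : ℕ) (a b : V) :
    evenDist G k a b = evenDist G k b a := by
  simp only [evenDist, truncDist_comm G k a b]

theorem evenDist_of_adj {G : SimpleGraph V} {k : ℕ} (hk : 1 ≤ k) {a b : V} (h : G.Adj a b) :
    evenDist G k a b = 2 * k := by
  simp [evenDist, truncDist_of_adj hk h]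

/-- Replacing two of three numbers `d` by `2k+1-d` permutes these four inequalities. If evenly many
of the distances are odd, they follow from the triangle inequality and `d ≤ k`; otherwise the
perimeter is odd and the previous bound enters as well. -/
theorem evenDist_bounds {G : SimpleGraph V} {k : ℕ}
    (hG : ((2 * k + 1 : ℕ) : ℕ∞) ≤ oddGirth G) (a b c : V) :
    evenDist G k a c ≤ evenDist G k a b + evenDist G k b c ∧
      evenDist G k a b + evenDist G k b c + evenDist G k a c ≤ 2 * (2 * k + 1) := by
  have t1 := truncDist_triangle G k a b c
  have t2 := truncDist_triangle G k a c b
  have t3 := truncDist_triangle G k b a c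
  rw [truncDist_comm G k c b] at t2
  rw [truncDist_comm G k b a] at t3
  have l1 := truncDist_le G k a b
  have l2 := truncDist_le G k b c
  have l3 := truncDist_le G k a c
  have hodd := le_truncDist_add_of_odd hG (a := a) (b := b) (c := c)
  rw [Nat.odd_iff] at hodd
  simp only [evenDist, Nat.even_iff]
  split_ifs <;> omega

end OddWalks

/-! ### Labelling by subsets and passage to the projective hypercube -/

section Labelling

/-- Any two finite sets have a third one at prescribed distances, if these distances satisfy the
obvious necessary conditions. -/
theorem exists_card_symmDiff {α : Type v} [Fintype α] [DecidableEq α] (A B : Finset α) {a b : ℕ}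
    (heven : Even ((A ∆ B).card + a + b)) (h1 : (A ∆ B).card ≤ a + b) (h2 : a ≤ (A ∆ B).card + b)
    (h3 : b ≤ (A ∆ B).card + a) (h4 : (A ∆ B).card + a + b ≤ 2 * Fintype.card α) :
    ∃ C : Finset α, (A ∆ C).card = a ∧ (B ∆ C).card = b := by
  rw [Nat.even_iff] at heven
  have hcompl := Finset.card_compl (A ∆ B)
  have hle := Finset.card_le_univ (A ∆ B)
  -- The sizes of `X` and `Y` solve `|X| + |Y| = a` and `|A ∆ B| - |X| + |Y| = b`; the four
  -- inequalities say that such subsets exist.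
  obtain ⟨X, hX, hXc⟩ := Finset.exists_subset_card_eq (s := A ∆ B)
    (n := ((A ∆ B).card + a - b) / 2) (by omega)
  obtain ⟨Y, hY, hYc⟩ := Finset.exists_subset_card_eq (s := (A ∆ B)ᶜ)
    (n := (a + b - (A ∆ B).card) / 2) (by omega)
  have hdisj : Disjoint X Y := Finset.disjoint_left.2 fun i hi hi' =>
    Finset.mem_compl.1 (hY hi') (hX hi)
  refine ⟨A ∆ (X ∪ Y), ?_, ?_⟩
  · rw [symmDiff_symmDiff_cancel_left, Finset.card_union_of_disjoint hdisj]
    omega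
  · have : B ∆ (A ∆ (X ∪ Y)) = ((A ∆ B) \ X) ∪ Y := by
      ext i
      have hi := @hX i
      have hi' := @hY i
      simp only [Finset.mem_symmDiff, Finset.mem_union, Finset.mem_sdiff, Finset.mem_compl]
        at hi hi' ⊢
      tauto
    rw [this, Finset.card_union_of_disjoint, Finset.card_sdiff_of_subset hX]
    · omega
    · exact Finset.disjoint_left.2 fun i hi hi' =>
        Finset.mem_compl.1 (hY hi') (Finset.mem_sdiff.1 hi).1

/-- A `K₄`-minor-free graph has a labelling by subsets of `α` that realizes, along its edges, any
given distances all of whose triples are realizable. -/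
theorem exists_labelling {V : Type u} [Finite V] {α : Type v} [Fintype α] [DecidableEq α]
    (e : V → V → ℕ) (hself : ∀ a, e a a = 0) (hcomm : ∀ a b, e a b = e b a)
    (heven : ∀ a b, Even (e a b)) (htri : ∀ a b c, e a c ≤ e a b + e b c)
    (hsum : ∀ a b c, e a b + e b c + e a c ≤ 2 * Fintype.card α)
    (H : SimpleGraph V) (hH : ¬ HasK4Minor H) :
    ∃ f : V → Finset α, ∀ a b, H.Adj a b → (f a ∆ f b).card = e a b := by
  classical
  induction hm : H.support.ncard using Nat.strong_induction_on generalizing H with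
  | _ m ih =>
  subst hm
  rcases H.support.eq_empty_or_nonempty with hemp | hne
  · refine ⟨fun _ => ∅, fun a b hab => ?_⟩
    have : a ∈ H.support := ⟨b, hab⟩
    simp [hemp] at this
  obtain ⟨v, ⟨u, hvu⟩, p, q, hpq⟩ := exists_isThin H hne hH
  -- The choice `w = u` covers a vertex `v` with a single neighbour.
  obtain ⟨w, hw, hn⟩ : ∃ w, (w = u ∨ H.Adj v w) ∧ ∀ z, H.Adj v z → z = u ∨ z = w := by
    by_cases h : ∃ w, H.Adj v w ∧ w ≠ u
    · obtain ⟨w, hw, hwu⟩ := h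
      refine ⟨w, .inr hw, fun z hz => ?_⟩
      have := hpq u hvu
      have := hpq w hw
      have := hpq z hz
      grind
    · push Not at h
      exact ⟨u, .inl rfl, fun z hz => .inl (h z hz)⟩
  obtain ⟨f, hf⟩ := ih _ (ncard_support_contract_lt hvu.symm) (contract H u v)
    (fun h => hH (h.of_contract hvu.symm)) rfl
  simp only [contract_adj hvu.ne'] at hf
  have huw : (f u ∆ f w).card = e u w := by
    by_cases h : w = u
    · simp [h, hself]
    · have hvw : H.Adj v w := hw.resolve_left h
      exact hf u w ⟨Ne.symm h, hvu.ne', hvw.ne', .inr (.inl ⟨rfl, hvw⟩)⟩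
  obtain ⟨C, hC1, hC2⟩ := exists_card_symmDiff (f u) (f w) (a := e u v) (b := e w v)
    (by rw [huw]; exact ((heven _ _).add (heven _ _)).add (heven _ _))
    (by rw [huw, hcomm w v]; exact htri _ _ _) (by rw [huw]; exact htri _ _ _)
    (by rw [huw, hcomm u w]; exact htri _ _ _)
    (by rw [huw]; have := hsum u w v; omega)
  have hv : ∀ z, H.Adj v z → (f z ∆ C).card = e z v := by
    intro z hz
    rcases hn z hz with rfl | rfl
    · exact hC1
    · exact hC2
  refine ⟨Function.update f v C, fun a b hab => ?_⟩
  by_cases hav : a = v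
  · subst hav
    rw [Function.update_self, Function.update_of_ne hab.ne', symmDiff_comm, hv b hab, hcomm]
  · by_cases hbv : b = v
    · subst hbv
      rw [Function.update_self, Function.update_of_ne hav, hv a hab.symm]
    · rw [Function.update_of_ne hav, Function.update_of_ne hbv]
      exact hf a b ⟨hab.ne, hav, hbv, .inl hab⟩

/-- The quotient map from the hypercube of dimension `d + 1` to the projective hypercube of
dimension `d`. -/
def hypercubeQuotient {d : ℕ} (A : Finset (Fin (d + 1))) : Fin d → ZMod 2 := fun j =>
  (if j.castSucc ∈ A then 1 else 0) + if Fin.last d ∈ A then 1 else 0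

/-- The sets differ in all coordinates but one. If they agree only in the last, the images differ
everywhere, by `J`. If they agree only in coordinate `i`, the change in the last coordinate cancels
all the others, leaving `e_i`. -/
theorem projectiveHypercube_adj_quotient {d : ℕ} (hd : 1 ≤ d) {A B : Finset (Fin (d + 1))}
    (h : (A ∆ B).card = d) :
    (projectiveHypercube d).Adj (hypercubeQuotient A) (hypercubeQuotient B) := by
  have hc : (A ∆ B)ᶜ.card = 1 := by rw [Finset.card_compl, h]; simp
  obtain ⟨i, hi⟩ := Finset.card_eq_one.1 hc
  have hmem : ∀ j, (j ∈ A ↔ j ∈ B) ↔ j = i := by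
    intro j
    have : j ∈ (A ∆ B)ᶜ ↔ j = i := by rw [hi, Finset.mem_singleton]
    rw [← this, Finset.mem_compl, Finset.mem_symmDiff]
    tauto
  have key : ∃ g ∈ Set.range (fun i : Fin d => (Pi.single i 1 : Fin d → ZMod 2)) ∪ {1},
      g ≠ 0 ∧ hypercubeQuotient A + g = hypercubeQuotient B := by
    induction i using Fin.lastCases with
    | last =>
      refine ⟨1, .inr rfl, ?_, ?_⟩
      · intro h0
        have := congrFun h0 ⟨0, hd⟩
        simp at this
      · ext j
        have h1 := hmem j.castSucc
        have h2 := hmem (Fin.last d)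
        have h3 : j.castSucc ≠ Fin.last d := Fin.castSucc_ne_last j
        simp only [h3, iff_false, iff_true] at h1 h2
        simp only [hypercubeQuotient, Pi.add_apply, Pi.one_apply, h2]
        by_cases a1 : j.castSucc ∈ A <;> by_cases a2 : j.castSucc ∈ B <;>
          by_cases a3 : Fin.last d ∈ B <;> simp [a1, a2, a3] at h1 ⊢ <;> decide
    | cast i =>
      refine ⟨Pi.single i 1, .inl ⟨i, rfl⟩, by simp, ?_⟩
      ext j
      have h1 := hmem j.castSucc
      have h2 := hmem (Fin.last d)
      have h3 : Fin.last d ≠ i.castSucc := (Fin.castSucc_ne_last i).symm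
      simp only [h3, iff_false, Fin.castSucc_inj] at h1 h2
      simp only [hypercubeQuotient, Pi.add_apply, Pi.single_apply]
      rcases eq_or_ne j i with rfl | a0
      · by_cases a1 : j.castSucc ∈ A <;> by_cases a2 : j.castSucc ∈ B <;>
          by_cases a3 : Fin.last d ∈ A <;> by_cases a4 : Fin.last d ∈ B <;>
          simp [a1, a2, a3, a4] at h1 h2 ⊢ <;> decide
      · by_cases a1 : j.castSucc ∈ A <;> by_cases a2 : j.castSucc ∈ B <;>
          by_cases a3 : Fin.last d ∈ A <;> by_cases a4 : Fin.last d ∈ B <;>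
          simp [a0, a1, a2, a3, a4] at h1 h2 ⊢ <;> decide
  obtain ⟨g, hg, hg0, hgeq⟩ := key
  rw [projectiveHypercube, SimpleGraph.addCayley_adj']
  refine ⟨fun heq => hg0 ?_, g, hg, .inl hgeq⟩
  rwa [← heq, add_eq_left] at hgeq

end Labelling

end HomBound

theorem mainTheorem2 (k : ℕ) (hk : 1 ≤ k) :
    HomBound.Bounds (HomBound.projectiveHypercube (2 * k)) (HomBound.SP (2 * k + 1)) := by
  intro V _ G hG
  obtain ⟨hK, hgirth⟩ := hG
  obtain ⟨f, hf⟩ := HomBound.exists_labelling (α := Fin (2 * k + 1)) (HomBound.evenDist G k)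
    (HomBound.evenDist_self G k) (HomBound.evenDist_comm G k) (HomBound.even_evenDist G k)
    (fun a b c => (HomBound.evenDist_bounds hgirth a b c).1)
    (fun a b c => by simpa using (HomBound.evenDist_bounds hgirth a b c).2) G hK
  refine ⟨⟨fun v => HomBound.hypercubeQuotient (f v), fun {a b} hab => ?_⟩⟩
  refine HomBound.projectiveHypercube_adj_quotient (by omega) ?_
  rw [hf a b hab, HomBound.evenDist_of_adj hk hab]
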